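/- \textbf{Setting.} Types are $A ::= a \mid A\otimes A \mid A\multimap A$, with $a$ ranging over a countably infinite set of type variables. Terms (up to renaming of bound variables) are $t ::= x \mid t\,s \mid \lambda x.t \mid (s,t) \mid \mathsf{let}\ (x,y)=s\ \mathsf{in}\ t$. The linear type assignment system has the rules: $x:A\vdash x:A$; exchange; from $x:A,\Gamma\vdash t:B$ infer $\Gamma\vdash\lambda x.t:A\multimap B$; from $\Gamma\vdash t:A\multimap B$ and $\Delta\vdash s:A$ infer $\Gamma,\Delta\vdash t\,s:B$; from $\Gamma\vdash s:A$ and $\Delta\vdash t:B$ infer $\Gamma,\Delta\vdash (s,t):A\otimes B$; from $\Gamma\vdash s:A\otimes B$ and $x:A,y:B,\Delta\vdash t:C$ infer $\Gamma,\Delta\vdash \mathsf{let}\ (x,y)=s\ \mathsf{in}\ t:C$; here $\Gamma,\Delta$ presupposes that $\Gamma$ and $\Delta$ declare no common variable. A closed term of type $A$ is a term $t$ with $\vdash t:A$. \textbf{Equality.} Let $C[\,]$ range over arbitrary one-hole contexts. $\to_{\beta\eta}$ is the closure under contexts of $(\lambda x.t)s\Rightarrow t[s/x]$, $\mathsf{let}\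 (x,y)=(u,v)\ \mathsf{in}\ w\Rightarrow w[u/x,v/y]$, $\lambda x.(t\,x)\Rightarrow t$ ($x$ not free in $t$) and $\mathsf{let}\ (x,y)=t\ \mathsf{in}\ (x,y)\Rightarrow t$. The commutative conversion is $C[\mathsf{let}\ (x,y)=t\ \mathsf{in}\ u]\leftrightarrow_{\rm c}\mathsf{let}\ (x,y)=t\ \mathsf{in}\ C[u]$, where $x,y$ are not free in $C[\,]$ and $C[\,]$ captures no free variable of $t$; $=_{\rm c}$ is the congruent equivalence relation that it generates, and $t\to_{\beta\eta{\rm c}}u$ means $t=_{\rm c}t'\to_{\beta\eta}u'=_{\rm c}u$ for some $t',u'$. The typed equality $\Gamma\vdash t=s:A$, written $t=_{\beta\eta{\rm c}}s$, is the smallest relation that is reflexive on typable terms, symmetric, transitive, contains $\Gamma\vdash t=t':A$ whenever $\Gamma\vdash t:A$ and $t\leftrightarrow_{\rm c}t'$ or $t\to_{\beta\eta{\rm c}}t'$, and is closed under the congruence rules corresponding to the typing rules for $\lambda$, application, pair and $\mathsf{let}$. \textbf{Poly-typability.} A type $P$ is a principal type of $t$ if for some $\Gamma$ we have $\Gamma\vdash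 t:P$ and, whenever $\Gamma'\vdash t:A'$, there is a type substitution $\theta$ with $A'=P\theta$ and $\Gamma'=\Gamma\theta$. Principal types, denoted $\mathrm{PT}(t)$, are determined up to renaming of type variables, and representatives for different terms (or different argument positions) may be chosen independently. Let $t,s_1,\dots,s_n$ be terms such that $\vdash t:A_1'\multimap\cdots\multimap A_n'\multimap B'$ for some types $A_1',\dots,A_n',B'$, and $\vdash s_j:A_j$ for all $j$. The term $t$ is poly-typable by $A_1\multimap\cdots\multimap A_n\multimap B$ with respect to $s_1,\dots,s_n$ if for some choice of principal types, some type substitution $\theta$ and some types $A_1'',\dots,A_n''$ we have $\theta(\mathrm{PT}(t))=A_1''\multimap\cdots\multimap A_n''\multimap B$ and $\theta(\mathrm{PT}(s_j))=A_j''$ for all $j$. \textbf{Theorem (Projection Lemma and its $n$-ary form).} Let $A$ be a type having at least one closed term. (1) For every type $B$ there is a closed term $t$ such that for every closed term $s$ of type $A$: $t$ is poly-typable by $A\multimap(B\multimap B)$ with respect to $s$, and $\vdash t\,s=_{\beta\eta{\rm c}} I: B\multimap B$, where $I=\lambda x.x$. (2) For every $n$ and every $i$ with $1\le i\le n$ there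 is a closed term $t$ such that for all closed terms $s_1,\dots,s_n$ of type $A$: $t$ is poly-typable by $\underbrace{A\multimap\cdots\multimap A}_{n}\multimap A$ with respect to $s_1,\dots,s_n$, and $\vdash t\,s_1\cdots s_n=_{\beta\eta{\rm c}}s_i:A$. -/

import Mathlib

namespace LinLam

/-- Types: type variables, tensor products and linear implications. -/
inductive Ty : Type
  | var (a : ℕ) : Ty
  | tensor (A B : Ty) : Ty
  | imp (A B : Ty) : Ty

/-- The unique extension of a type substitution to types. -/
def Ty.subst (θ : ℕ → Ty) : Ty → Ty
  | .var a => θ a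
  | .tensor A B => .tensor (A.subst θ) (B.subst θ)
  | .imp A B => .imp (A.subst θ) (B.subst θ)

/-- `arrows [A₁, …, Aₙ] B` is `A₁ ⊸ (A₂ ⊸ ⋯ (Aₙ ⊸ B))`. -/
def Ty.arrows (As : List Ty) (B : Ty) : Ty := As.foldr Ty.imp B

/-- Untyped terms up to renaming of bound variables (de Bruijn indices).
`lam t` is `fn x => t` and binds index `0` in `t`.
`letp s t` is `let val (x,y) = s in t end`; in `t` the index `1` is `x` and the index `0` is `y`. -/
inductive Tm : Type
  | var (i : ℕ) : Tm
  | app (t s : Tm) : Tm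
  | lam (t : Tm) : Tm
  | pair (s t : Tm) : Tm
  | letp (s t : Tm) : Tm

/-- Extension of a renaming under one binder. -/
def liftRen (ρ : ℕ → ℕ) : ℕ → ℕ
  | 0 => 0
  | i + 1 => ρ i + 1

def Tm.rename (ρ : ℕ → ℕ) : Tm → Tm
  | .var i => .var (ρ i)
  | .app t s => .app (t.rename ρ) (s.rename ρ)
  | .lam t => .lam (t.rename (liftRen ρ))
  | .pair s t => .pair (s.rename ρ) (t.rename ρ)
  | .letp s t => .letp (s.rename ρ) (t.rename (liftRen (liftRen ρ)))

/-- Extension of a substitution under one binder. -/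
def liftSub (σ : ℕ → Tm) : ℕ → Tm
  | 0 => .var 0
  | i + 1 => (σ i).rename Nat.succ

/-- Simultaneous capture-avoiding substitution. -/
def Tm.subst (σ : ℕ → Tm) : Tm → Tm
  | .var i => σ i
  | .app t s => .app (t.subst σ) (s.subst σ)
  | .lam t => .lam (t.subst (liftSub σ))
  | .pair s t => .pair (s.subst σ) (t.subst σ)
  | .letp s t => .letp (s.subst σ) (t.subst (liftSub (liftSub σ)))

/-- The substitution of `s` for the innermost bound variable. -/
def sub1 (s : Tm) : ℕ → Tm
  | 0 => s
  | i + 1 => .var i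

/-- The substitution of `u` for `x` (index `1`) and `v` for `y` (index `0`). -/
def sub2 (u v : Tm) : ℕ → Tm
  | 0 => v
  | 1 => u
  | i + 2 => .var i

/-- The combinator `I = fn x => x`. -/
def Tm.I : Tm := .lam (.var 0)

/-- `apps t [s₁, …, sₙ]` is `t s₁ ⋯ sₙ`. -/
def Tm.apps (t : Tm) (ss : List Tm) : Tm := ss.foldl Tm.app t

/-- Typing contexts: `Γ i = some A` says that the variable `i` is declared with type `A`,
`Γ i = none` that it is not declared. The order of the declarations is immaterial, which
accounts for the exchange rule. -/
abbrev Ctx : Type := ℕ → Option Ty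

def Ctx.empty : Ctx := fun _ => none

/-- The context whose only declaration is `i : A`. -/
def Ctx.single (i : ℕ) (A : Ty) : Ctx := fun j => if j = i then some A else none

/-- The context `x : A, Γ` where `x` is the new variable with index `0`. -/
def Ctx.cons (A : Ty) (Γ : Ctx) : Ctx
  | 0 => some A
  | i + 1 => Γ i

def Ctx.subst (θ : ℕ → Ty) (Γ : Ctx) : Ctx := fun i => (Γ i).map (Ty.subst θ)

/-- `Γ` is the union `Γ₁, Γ₂` of two contexts that declare no common variable. -/
def Ctx.Split (Γ Γ₁ Γ₂ : Ctx) : Prop :=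
  ∀ i, (Γ i = Γ₁ i ∧ Γ₂ i = none) ∨ (Γ i = Γ₂ i ∧ Γ₁ i = none)

/-- The type assignment system `Γ ⊢ t : A`. -/
inductive HasType : Ctx → Tm → Ty → Prop
  | var (i : ℕ) (A : Ty) : HasType (Ctx.single i A) (.var i) A
  | lam {Γ : Ctx} {t : Tm} {A B : Ty} :
      HasType (Ctx.cons A Γ) t B → HasType Γ (.lam t) (.imp A B)
  | app {Γ Γ₁ Γ₂ : Ctx} {t s : Tm} {A B : Ty} : Ctx.Split Γ Γ₁ Γ₂ →
      HasType Γ₁ t (.imp A B) → HasType Γ₂ s A → HasType Γ (.app t s) B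
  | pair {Γ Γ₁ Γ₂ : Ctx} {s t : Tm} {A B : Ty} : Ctx.Split Γ Γ₁ Γ₂ →
      HasType Γ₁ s A → HasType Γ₂ t B → HasType Γ (.pair s t) (.tensor A B)
  | letp {Γ Γ₁ Γ₂ : Ctx} {s t : Tm} {A B C : Ty} : Ctx.Split Γ Γ₁ Γ₂ →
      HasType Γ₁ s (.tensor A B) → HasType (Ctx.cons B (Ctx.cons A Γ₂)) t C →
      HasType Γ (.letp s t) C

/-- `t` is a closed (linear) term of type `A`, that is `⊢ t : A`. -/
def ClosedTerm (t : Tm) (A : Ty) : Prop := HasType Ctx.empty t A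

/-- Contexts `C[]`: terms with one hole, which may capture variables. -/
inductive TCtx : Type
  | hole : TCtx
  | appL (C : TCtx) (t : Tm) : TCtx
  | appR (t : Tm) (C : TCtx) : TCtx
  | pairL (C : TCtx) (t : Tm) : TCtx
  | pairR (t : Tm) (C : TCtx) : TCtx
  | lam (C : TCtx) : TCtx
  | letL (C : TCtx) (t : Tm) : TCtx
  | letR (t : Tm) (C : TCtx) : TCtx

/-- `C[u]`. -/
def TCtx.plug : TCtx → Tm → Tm
  | .hole, u => u
  | .appL C t, u => .app (C.plug u) t
  | .appR t C, u => .app t (C.plug u)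
  | .pairL C t, u => .pair (C.plug u) t
  | .pairR t C, u => .pair t (C.plug u)
  | .lam C, u => .lam (C.plug u)
  | .letL C t, u => .letp (C.plug u) t
  | .letR t C, u => .letp t (C.plug u)

/-- The number of variables captured by a context; at the hole these are the indices below it. -/
def TCtx.depth : TCtx → ℕ
  | .hole => 0
  | .appL C _ => C.depth
  | .appR _ C => C.depth
  | .pairL C _ => C.depth
  | .pairR _ C => C.depth
  | .lam C => C.depth + 1
  | .letL C _ => C.depth
  | .letR _ C => C.depth + 2

/-- Renaming of the free variables of a context. -/
def TCtx.rename (ρ : ℕ → ℕ) : TCtx → TCtx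
  | .hole => .hole
  | .appL C t => .appL (C.rename ρ) (t.rename ρ)
  | .appR t C => .appR (t.rename ρ) (C.rename ρ)
  | .pairL C t => .pairL (C.rename ρ) (t.rename ρ)
  | .pairR t C => .pairR (t.rename ρ) (C.rename ρ)
  | .lam C => .lam (C.rename (liftRen ρ))
  | .letL C t => .letL (C.rename ρ) (t.rename (liftRen (liftRen ρ)))
  | .letR t C => .letR (t.rename ρ) (C.rename (liftRen (liftRen ρ)))

/-- The congruent relation generated by `R` and any context `C[]`. -/
inductive Cong (R : Tm → Tm → Prop) : Tm → Tm → Prop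
  | mk (C : TCtx) {t u : Tm} : R t u → Cong R (C.plug t) (C.plug u)

/-- The rules `β₁`, `β₂`, `η₁`, `η₂`. In `η₁` the bound variable does not occur in `t`. -/
inductive BetaEtaRule : Tm → Tm → Prop
  | beta1 (t s : Tm) : BetaEtaRule (.app (.lam t) s) (t.subst (sub1 s))
  | beta2 (u v w : Tm) : BetaEtaRule (.letp (.pair u v) w) (w.subst (sub2 u v))
  | eta1 (t : Tm) : BetaEtaRule (.lam (.app (t.rename Nat.succ) (.var 0))) t
  | eta2 (t : Tm) : BetaEtaRule (.letp t (.pair (.var 1) (.var 0))) t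

/-- One-step reduction `→_{βη}`. -/
def StepBetaEta : Tm → Tm → Prop := Cong BetaEtaRule

/-- Exchange of the two variables of a `let` (indices `0`, `1`) with the next `d` variables. -/
def swapRen (d : ℕ) (i : ℕ) : ℕ := if i < 2 then i + d else if i < d + 2 then i - 2 else i

/-- `C[let val (x,y) = t in u end] ↔ let val (x,y) = t in C[u] end`, read in both directions,
where `x`, `y` are not free in `C` and `C` captures no free variable of `t`. Both side conditions
are expressed by the index shifts: on the left `t` is moved under the binders of `C` and on the
right `C` is moved under the binders `x`, `y`. -/
inductive CommConv : Tm → Tm → Prop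
  | out (C : TCtx) (t u : Tm) :
      CommConv (C.plug (.letp (t.rename (· + C.depth)) u))
        (.letp t ((C.rename (· + 2)).plug (u.rename (swapRen C.depth))))
  | into (C : TCtx) (t u : Tm) :
      CommConv (.letp t ((C.rename (· + 2)).plug (u.rename (swapRen C.depth))))
        (C.plug (.letp (t.rename (· + C.depth)) u))

/-- The congruent equivalence relation `=_c` generated by commutative conversion. -/
def EqComm : Tm → Tm → Prop := Relation.EqvGen (Cong CommConv)

/-- The relation `→_{βηc}`. -/
def StepBetaEtaC (t u : Tm) : Prop :=
  ∃ t' u', EqComm t t' ∧ StepBetaEta t' u' ∧ EqComm u' u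

/-- The typed equality `Γ ⊢ t = s : A` (that is `=_{βηc}`). -/
inductive EqTm : Ctx → Tm → Tm → Ty → Prop
  | refl {Γ : Ctx} {t : Tm} {A : Ty} : HasType Γ t A → EqTm Γ t t A
  | symm {Γ : Ctx} {t s : Tm} {A : Ty} : EqTm Γ t s A → EqTm Γ s t A
  | trans {Γ : Ctx} {t s u : Tm} {A : Ty} : EqTm Γ t s A → EqTm Γ s u A → EqTm Γ t u A
  | comm {Γ : Ctx} {t t' : Tm} {A : Ty} : HasType Γ t A → CommConv t t' → EqTm Γ t t' A
  | red {Γ : Ctx} {t t' : Tm} {A : Ty} : HasType Γ t A → StepBetaEtaC t t' → EqTm Γ t t' A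
  | lam {Γ : Ctx} {t t' : Tm} {A B : Ty} :
      EqTm (Ctx.cons A Γ) t t' B → EqTm Γ (.lam t) (.lam t') (.imp A B)
  | app {Γ Γ₁ Γ₂ : Ctx} {t t' s s' : Tm} {A B : Ty} : Ctx.Split Γ Γ₁ Γ₂ →
      EqTm Γ₁ t t' (.imp A B) → EqTm Γ₂ s s' A → EqTm Γ (.app t s) (.app t' s') B
  | pair {Γ Γ₁ Γ₂ : Ctx} {s s' t t' : Tm} {A B : Ty} : Ctx.Split Γ Γ₁ Γ₂ →
      EqTm Γ₁ s s' A → EqTm Γ₂ t t' B → EqTm Γ (.pair s t) (.pair s' t') (.tensor A B)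
  | letp {Γ Γ₁ Γ₂ : Ctx} {s s' t t' : Tm} {A B C : Ty} : Ctx.Split Γ Γ₁ Γ₂ →
      EqTm Γ₁ s s' (.tensor A B) → EqTm (Ctx.cons B (Ctx.cons A Γ₂)) t t' C →
      EqTm Γ (.letp s t) (.letp s' t') C

/-- `P` is a principal type of `t`. It is determined by `t` only up to renaming of type
variables. -/
def IsPrincipalType (t : Tm) (P : Ty) : Prop :=
  ∃ Γ : Ctx, HasType Γ t P ∧
    ∀ (Γ' : Ctx) (A' : Ty), HasType Γ' t A' →
      ∃ θ : ℕ → Ty, A' = P.subst θ ∧ Γ' = Γ.subst θ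

/-- `t` is poly-typable by `A ⊸ B` with respect to `s`. Principal types are taken up to renaming
of type variables, so those of `t` and `s` may be chosen with different variables. -/
def PolyTypable (t s : Tm) (A B : Ty) : Prop :=
  (∃ A' B' : Ty, ClosedTerm t (.imp A' B')) ∧ ClosedTerm s A ∧
    ∃ (P Q : Ty) (θ : ℕ → Ty) (A₀ : Ty), IsPrincipalType t P ∧ IsPrincipalType s Q ∧
      P.subst θ = .imp A₀ B ∧ Q.subst θ = A₀

/-- `t` is poly-typable by `A₁ ⊸ ⋯ ⊸ Aₙ ⊸ B` with respect to `s₁, …, sₙ`. -/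
def PolyTypableN {n : ℕ} (t : Tm) (s : Fin n → Tm) (A : Fin n → Ty) (B : Ty) : Prop :=
  (∃ (A' : Fin n → Ty) (B' : Ty), ClosedTerm t (Ty.arrows (List.ofFn A') B')) ∧
    (∀ j, ClosedTerm (s j) (A j)) ∧
    ∃ (P : Ty) (Q : Fin n → Ty) (θ : ℕ → Ty) (A'' : Fin n → Ty),
      IsPrincipalType t P ∧ (∀ j, IsPrincipalType (s j) (Q j)) ∧
        P.subst θ = Ty.arrows (List.ofFn A'') B ∧ ∀ j, (Q j).subst θ = A'' j

end LinLam

namespace LinLam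

/-! ### Type substitutions -/

/-! A linear term cannot discard its argument, but it can reduce it to an identity. Instantiate
every type variable of `A` by `B ⊸ B`. A logical relation `Red` singles out the terms whose parts of
variable type are equal to `I`; by its fundamental lemma `HasType.red`, every closed term of type
`A` lies in it. Induction on `A` then builds an eraser into a type variable together with an
inhabitant (`Red.exists_erase_and_gen`). Erasing a closed term of type `A` gives an element of `Red`
at a variable, that is, a term equal to `I` at `B ⊸ B`. For projections, the resulting identity is
applied to whatever has to be returned, and unwanted arguments are erased one by one.

The eraser uses an instance of `A`, not `A` itself, and different arguments may need different
instances. Poly-typability allows this: closed typable terms have principal types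
(`ClosedTerm.exists_principalType`), and once their variables are made disjoint a single
substitution realises all the instances (`exists_principalTypes_subst`). Principal types are
obtained without unification, from closure of the typings under anti-unification. -/

theorem Ty.subst_var (A : Ty) : A.subst Ty.var = A := by
  induction A <;> simp_all [Ty.subst]

theorem Ty.subst_subst (θ η : ℕ → Ty) (A : Ty) :
    (A.subst θ).subst η = A.subst (fun a => (θ a).subst η) := by
  induction A <;> simp_all [Ty.subst]

theorem Ctx.subst_single (θ : ℕ → Ty) (i : ℕ) (A : Ty) :
    (Ctx.single i A).subst θ = Ctx.single i (A.subst θ) := by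
  funext j
  by_cases h : j = i <;> simp [Ctx.subst, Ctx.single, h]

theorem Ctx.subst_cons (θ : ℕ → Ty) (A : Ty) (Γ : Ctx) :
    (Ctx.cons A Γ).subst θ = Ctx.cons (A.subst θ) (Γ.subst θ) := by
  funext j
  cases j <;> rfl

theorem Ctx.Split.tySubst {Γ Γ₁ Γ₂ : Ctx} (h : Ctx.Split Γ Γ₁ Γ₂) (θ : ℕ → Ty) :
    Ctx.Split (Γ.subst θ) (Γ₁.subst θ) (Γ₂.subst θ) := by
  intro i
  rcases h i with ⟨h1, h2⟩ | ⟨h1, h2⟩ <;> simp [Ctx.subst, h1, h2]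

theorem HasType.tySubst {Γ : Ctx} {t : Tm} {A : Ty} (h : HasType Γ t A) (θ : ℕ → Ty) :
    HasType (Γ.subst θ) t (A.subst θ) := by
  induction h with
  | var i A => rw [Ctx.subst_single]; exact .var _ _
  | lam _ ih => rw [Ctx.subst_cons] at ih; exact .lam ih
  | app hs _ _ ih1 ih2 => exact .app (hs.tySubst θ) ih1 ih2
  | pair hs _ _ ih1 ih2 => exact .pair (hs.tySubst θ) ih1 ih2
  | letp hs _ _ ih1 ih2 =>
    rw [Ctx.subst_cons, Ctx.subst_cons] at ih2
    exact .letp (hs.tySubst θ) ih1 ih2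

theorem ClosedTerm.tySubst {t : Tm} {A : Ty} (h : ClosedTerm t A) (θ : ℕ → Ty) :
    ClosedTerm t (A.subst θ) :=
  HasType.tySubst h θ

/-! ### Principal types, by anti-unification of typings -/

/-- An injection of types into natural numbers. -/
def Ty.code : Ty → ℕ
  | .var a => Nat.pair 0 a
  | .tensor A B => Nat.pair 1 (Nat.pair A.code B.code)
  | .imp A B => Nat.pair 2 (Nat.pair A.code B.code)

theorem Ty.code_injective : Function.Injective Ty.code := by
  intro A
  induction A with
  | var a => intro B h; cases B <;> simp_all [Ty.code, Nat.pair_eq_pair]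
  | tensor A₁ A₂ ih1 ih2 =>
    intro B h
    cases B <;> simp [Ty.code, Nat.pair_eq_pair] at h
    rw [ih1 h.1, ih2 h.2]
  | imp A₁ A₂ ih1 ih2 =>
    intro B h
    cases B <;> simp [Ty.code, Nat.pair_eq_pair] at h
    rw [ih1 h.1, ih2 h.2]

instance : Inhabited Ty := ⟨.var 0⟩

noncomputable def Ty.decode : ℕ → Ty := Function.invFun Ty.code

theorem Ty.decode_code (A : Ty) : Ty.decode A.code = A :=
  Function.leftInverse_invFun Ty.code_injective A

/-- The least general common generalization of two types. -/
def Ty.lgg : Ty → Ty → Ty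
  | .tensor A B, .tensor A' B' => .tensor (A.lgg A') (B.lgg B')
  | .imp A B, .imp A' B' => .imp (A.lgg A') (B.lgg B')
  -- The variable records the mismatched pair, so decoding either component recovers that side, and
  -- equal mismatches share a variable.
  | A, A' => .var (Nat.pair A.code A'.code)

theorem Ty.lgg_subst_left (A A' : Ty) :
    (A.lgg A').subst (fun n => Ty.decode n.unpair.1) = A := by
  induction A generalizing A' <;> cases A' <;> simp_all [Ty.lgg, Ty.subst, Ty.decode_code]

theorem Ty.lgg_subst_right (A A' : Ty) :
    (A.lgg A').subst (fun n => Ty.decode n.unpair.2) = A' := by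
  induction A generalizing A' <;> cases A' <;> simp_all [Ty.lgg, Ty.subst, Ty.decode_code]

def Ctx.lgg (Γ Γ' : Ctx) : Ctx := fun i =>
  match Γ i, Γ' i with
  | some A, some A' => some (A.lgg A')
  | _, _ => none

theorem Ctx.lgg_cons (A A' : Ty) (Γ Γ' : Ctx) :
    Ctx.lgg (Ctx.cons A Γ) (Ctx.cons A' Γ') = Ctx.cons (A.lgg A') (Ctx.lgg Γ Γ') := by
  funext i
  cases i <;> rfl

theorem Ctx.lgg_single (i : ℕ) (A A' : Ty) :
    Ctx.lgg (Ctx.single i A) (Ctx.single i A') = Ctx.single i (A.lgg A') := by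
  funext j
  by_cases h : j = i <;> simp [Ctx.lgg, Ctx.single, h]

/-- There is no weakening, so a typing context declares exactly the free variables of the term. -/
theorem HasType.dom_unique {Γ Γ' : Ctx} {t : Tm} {A A' : Ty} (h : HasType Γ t A)
    (h' : HasType Γ' t A') (i : ℕ) : Γ i = none ↔ Γ' i = none := by
  induction h generalizing Γ' A' i with
  | var j A => cases h'; by_cases h : i = j <;> simp [Ctx.single, h]
  | lam _ ih => cases h' with | lam h' => exact ih h' (i + 1)
  | app hs _ _ ih1 ih2 =>
    cases h' with
    | app hs' h1 h2 =>
      have := ih1 h1 i; have := ih2 h2 i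
      rcases hs i with ⟨_, _⟩ | ⟨_, _⟩ <;> rcases hs' i with ⟨_, _⟩ | ⟨_, _⟩ <;> simp_all
  | pair hs _ _ ih1 ih2 =>
    cases h' with
    | pair hs' h1 h2 =>
      have := ih1 h1 i; have := ih2 h2 i
      rcases hs i with ⟨_, _⟩ | ⟨_, _⟩ <;> rcases hs' i with ⟨_, _⟩ | ⟨_, _⟩ <;> simp_all
  | letp hs _ _ ih1 ih2 =>
    cases h' with
    | letp hs' h1 h2 =>
      have := ih1 h1 i
      have : _ ↔ _ := ih2 h2 (i + 2)
      simp only [Ctx.cons] at this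
      rcases hs i with ⟨_, _⟩ | ⟨_, _⟩ <;> rcases hs' i with ⟨_, _⟩ | ⟨_, _⟩ <;> simp_all

theorem Ctx.Split.lgg {Γ Γ₁ Γ₂ Γ' Γ₁' Γ₂' : Ctx} (h : Ctx.Split Γ Γ₁ Γ₂)
    (h' : Ctx.Split Γ' Γ₁' Γ₂') (h1 : ∀ i, Γ₁ i = none ↔ Γ₁' i = none)
    (h2 : ∀ i, Γ₂ i = none ↔ Γ₂' i = none) :
    Ctx.Split (Γ.lgg Γ') (Γ₁.lgg Γ₁') (Γ₂.lgg Γ₂') := by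
  intro i
  have := h1 i; have := h2 i
  rcases h i with ⟨_, _⟩ | ⟨_, _⟩ <;> rcases h' i with ⟨_, _⟩ | ⟨_, _⟩ <;>
    simp_all [Ctx.lgg]

/-- The rules are syntax-directed, so two derivations for `t` have the same shape and can be
generalized node by node; equal domains make the context splits agree. -/
theorem HasType.lgg {Γ Γ' : Ctx} {t : Tm} {A A' : Ty} (h : HasType Γ t A)
    (h' : HasType Γ' t A') : HasType (Γ.lgg Γ') t (A.lgg A') := by
  induction h generalizing Γ' A' with
  | var j A => cases h'; rw [Ctx.lgg_single]; exact .var _ _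
  | lam _ ih =>
    cases h' with
    | lam h' => have := ih h'; rw [Ctx.lgg_cons] at this; exact .lam this
  | app hs h1 h2 ih1 ih2 =>
    cases h' with
    | app hs' h1' h2' =>
      exact .app (hs.lgg hs' (h1.dom_unique h1') (h2.dom_unique h2')) (ih1 h1') (ih2 h2')
  | pair hs h1 h2 ih1 ih2 =>
    cases h' with
    | pair hs' h1' h2' =>
      exact .pair (hs.lgg hs' (h1.dom_unique h1') (h2.dom_unique h2')) (ih1 h1') (ih2 h2')
  | letp hs h1 h2 ih1 ih2 =>
    cases h' with
    | letp hs' h1' h2' =>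
      have := ih2 h2'
      rw [Ctx.lgg_cons, Ctx.lgg_cons] at this
      exact .letp (hs.lgg hs' (h1.dom_unique h1') (fun i => h2.dom_unique h2' (i + 2)))
        (ih1 h1') this

/-! ### Most general elements and existence of principal types -/

def Ty.size : Ty → ℕ
  | .var _ => 1
  | .tensor A B => A.size + B.size + 1
  | .imp A B => A.size + B.size + 1

def Ty.vars : Ty → Finset ℕ
  | .var a => {a}
  | .tensor A B => A.vars ∪ B.vars
  | .imp A B => A.vars ∪ B.vars

theorem Ty.card_vars_le (A : Ty) : A.vars.card ≤ A.size := by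
  induction A with
  | var a => simp [Ty.vars, Ty.size]
  | tensor A B ih1 ih2 | imp A B ih1 ih2 =>
    have := Finset.card_union_le A.vars B.vars
    simp only [Ty.vars, Ty.size]; omega

theorem Ty.size_pos (A : Ty) : 0 < A.size := by
  cases A <;> simp [Ty.size]

theorem Ty.size_le_subst (θ : ℕ → Ty) (A : Ty) : A.size ≤ (A.subst θ).size := by
  induction A with
  | var a => exact (θ a).size_pos
  | tensor A B ih1 ih2 | imp A B ih1 ih2 => simp only [Ty.size, Ty.subst]; omega

theorem Ty.subst_congr {θ η : ℕ → Ty} {A : Ty} (h : ∀ a ∈ A.vars, θ a = η a) :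
    A.subst θ = A.subst η := by
  induction A with
  | var a => exact h a (by simp [Ty.vars])
  | tensor A B ih1 ih2 | imp A B ih1 ih2 =>
    simp only [Ty.vars, Finset.mem_union] at h
    simp [Ty.subst, ih1 fun a ha => h a (.inl ha), ih2 fun a ha => h a (.inr ha)]

/-- Replacing an occurring variable by a compound type strictly increases the size. -/
theorem Ty.isVar_of_size_subst_le {θ : ℕ → Ty} {A : Ty} (h : (A.subst θ).size ≤ A.size) :
    ∀ a ∈ A.vars, ∃ b, θ a = .var b := by
  induction A with
  | var a =>
    simp only [Ty.vars, Finset.mem_singleton, forall_eq]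
    simp only [Ty.subst, Ty.size] at h
    cases hθ : θ a with
    | var b => exact ⟨b, rfl⟩
    | tensor A B | imp A B =>
      rw [hθ] at h
      have := A.size_pos
      simp only [Ty.size] at h; omega
  | tensor A B ih1 ih2 | imp A B ih1 ih2 =>
    have := A.size_le_subst θ
    have := B.size_le_subst θ
    simp only [Ty.subst, Ty.size] at h
    simp only [Ty.vars, Finset.mem_union]
    rintro a (ha | ha)
    · exact ih1 (by omega) a ha
    · exact ih2 (by omega) a ha

theorem Ty.vars_subst_var (ρ : ℕ → ℕ) (A : Ty) :
    (A.subst fun a => .var (ρ a)).vars = A.vars.image ρ := by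
  induction A <;> simp_all [Ty.subst, Ty.vars, Finset.image_union]

/-- A nonempty set of types closed under least general generalization has a most general
element. -/
theorem exists_most_general {S : Set Ty} (hne : S.Nonempty)
    (hS : ∀ A ∈ S, ∀ B ∈ S, A.lgg B ∈ S) : ∃ M ∈ S, ∀ N ∈ S, ∃ θ, N = M.subst θ := by
  obtain ⟨M₀, hM₀, hmin₀⟩ := (measure Ty.size).wf.has_min S hne
  -- Among the types of least size, `M` has the most distinct variables; the truncated subtraction
  -- is harmless because a type has at most as many variables as its size.
  obtain ⟨M, ⟨hM, hMs⟩, hmin⟩ := (measure fun A : Ty => M₀.size - A.vars.card).wf.has_min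
    {A | A ∈ S ∧ A.size = M₀.size} ⟨M₀, hM₀, rfl⟩
  refine ⟨M, hM, fun N hN => ?_⟩
  have hLM := Ty.lgg_subst_left M N
  have hLN := Ty.lgg_subst_right M N
  have hL := hS M hM N hN
  generalize M.lgg N = L at hLM hLN hL
  generalize (fun n => Ty.decode (Nat.unpair n).1) = θ at hLM
  generalize (fun n => Ty.decode (Nat.unpair n).2) = η at hLN
  have h1 : L.size ≤ M.size := hLM ▸ L.size_le_subst θ
  have h2 : ¬ L.size < M₀.size := hmin₀ L hL
  have h3 : ¬ M₀.size - L.vars.card < M₀.size - M.vars.card := hmin L ⟨hL, by omega⟩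
  have h4 := M.card_vars_le
  have h5 := L.card_vars_le
  -- `L` generalizes `M` and has the same size, so `θ` only renames variables; maximality of the
  -- variable count of `M` makes this renaming injective on `L`. Undoing it and then applying `η`
  -- leads from `M` to `N`.
  have hvar := Ty.isVar_of_size_subst_le (θ := θ) (A := L) (by rw [hLM]; omega)
  choose! ρ hρ using hvar
  have hLM' : L.subst (fun a => .var (ρ a)) = M := by
    rw [← hLM]; exact Ty.subst_congr fun a ha => (hρ a ha).symm
  have hcard : (L.vars.image ρ).card = L.vars.card := by
    refine le_antisymm Finset.card_image_le ?_
    rw [← Ty.vars_subst_var, hLM']; omega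
  have hinj := Finset.card_image_iff.mp hcard
  refine ⟨fun b => η (Function.invFunOn ρ L.vars b), ?_⟩
  rw [← hLM', Ty.subst_subst, ← hLN]
  refine Ty.subst_congr fun a ha => ?_
  simp only [Ty.subst]
  rw [hinj.leftInvOn_invFunOn ha]

theorem HasType.ctx_eq_empty {Γ : Ctx} {t : Tm} {A A' : Ty} (h : ClosedTerm t A)
    (h' : HasType Γ t A') : Γ = Ctx.empty :=
  funext fun i => (h.dom_unique h' i).mp rfl

theorem ClosedTerm.exists_principalType {t : Tm} {A : Ty} (h : ClosedTerm t A) :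
    ∃ P, IsPrincipalType t P := by
  obtain ⟨P, hP, hmg⟩ := exists_most_general (S := {A | ClosedTerm t A}) ⟨A, h⟩
    fun _ hA _ hB => HasType.lgg hA hB
  refine ⟨P, Ctx.empty, hP, fun Γ' A' h' => ?_⟩
  obtain rfl := HasType.ctx_eq_empty h h'
  obtain ⟨θ, hθ⟩ := hmg A' h'
  exact ⟨θ, hθ, rfl⟩

theorem IsPrincipalType.exists_subst {t : Tm} {P A : Ty} (h : IsPrincipalType t P)
    (hA : ClosedTerm t A) : ∃ θ, A = P.subst θ := by
  obtain ⟨Γ, -, hmg⟩ := h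
  obtain ⟨θ, hθ, -⟩ := hmg _ _ hA
  exact ⟨θ, hθ⟩

theorem IsPrincipalType.rename {t : Tm} {P : Ty} (h : IsPrincipalType t P) {ρ : ℕ → ℕ}
    (hρ : Function.Injective ρ) : IsPrincipalType t (P.subst fun a => .var (ρ a)) := by
  obtain ⟨Γ, hP, hmg⟩ := h
  refine ⟨_, hP.tySubst _, fun Γ' A' h' => ?_⟩
  obtain ⟨θ, rfl, rfl⟩ := hmg Γ' A' h'
  refine ⟨fun b => θ (Function.invFun ρ b), ?_, ?_⟩
  · rw [Ty.subst_subst]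
    simp [Ty.subst, Function.leftInverse_invFun hρ _]
  · funext i
    simp [Ctx.subst, Ty.subst_subst, Ty.subst, Function.leftInverse_invFun hρ _,
      Function.comp_def]

/-- Principal types of countably many closed terms can be chosen with disjoint variables, so
that one type substitution produces given types of all these terms. -/
theorem exists_principalTypes_subst {t : ℕ → Tm} {A : ℕ → Ty}
    (h : ∀ k, ClosedTerm (t k) (A k)) :
    ∃ (P : ℕ → Ty) (θ : ℕ → Ty), ∀ k, IsPrincipalType (t k) (P k) ∧ (P k).subst θ = A k := by
  choose P hP using fun k => (h k).exists_principalType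
  choose θ hθ using fun k => (hP k).exists_subst (h k)
  -- Tagging each variable with the index `k` makes the variable sets disjoint.
  refine ⟨fun k => (P k).subst fun a => .var (Nat.pair k a),
    fun n => θ n.unpair.1 n.unpair.2, fun k => ⟨(hP k).rename fun a b hab => ?_, ?_⟩⟩
  · exact (Nat.pair_eq_pair.mp hab).2
  · rw [Ty.subst_subst, hθ k]
    simp [Ty.subst]

/-! ### Substitution of terms -/

theorem liftRen_comp (ρ ξ : ℕ → ℕ) :
    liftRen (fun i => ξ (ρ i)) = fun i => liftRen ξ (liftRen ρ i) := by
  funext i; cases i <;> rfl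

theorem liftSub_liftRen (σ : ℕ → Tm) (ρ : ℕ → ℕ) :
    liftSub (fun i => σ (ρ i)) = fun i => liftSub σ (liftRen ρ i) := by
  funext i; cases i <;> rfl

theorem Tm.rename_rename (ρ ξ : ℕ → ℕ) (t : Tm) :
    (t.rename ρ).rename ξ = t.rename fun i => ξ (ρ i) := by
  induction t generalizing ρ ξ <;> simp_all [Tm.rename, liftRen_comp]

theorem Tm.subst_rename (ρ : ℕ → ℕ) (σ : ℕ → Tm) (t : Tm) :
    (t.rename ρ).subst σ = t.subst fun i => σ (ρ i) := by
  induction t generalizing ρ σ <;> simp_all [Tm.rename, Tm.subst, liftSub_liftRen]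

theorem liftSub_rename (σ : ℕ → Tm) (ρ : ℕ → ℕ) :
    liftSub (fun i => (σ i).rename ρ) = fun i => (liftSub σ i).rename (liftRen ρ) := by
  funext i
  cases i with
  | zero => rfl
  | succ i => simp [liftSub, Tm.rename_rename, liftRen]

theorem Tm.rename_subst (σ : ℕ → Tm) (ρ : ℕ → ℕ) (t : Tm) :
    (t.subst σ).rename ρ = t.subst fun i => (σ i).rename ρ := by
  induction t generalizing ρ σ <;> simp_all [Tm.rename, Tm.subst, liftSub_rename]

theorem liftSub_subst (σ τ : ℕ → Tm) :
    liftSub (fun i => (σ i).subst τ) = fun i => (liftSub σ i).subst (liftSub τ) := by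
  funext i
  cases i with
  | zero => rfl
  | succ i => simp [liftSub, Tm.rename_subst, Tm.subst_rename]

theorem Tm.subst_subst (σ τ : ℕ → Tm) (t : Tm) :
    (t.subst σ).subst τ = t.subst fun i => (σ i).subst τ := by
  induction t generalizing σ τ <;> simp_all [Tm.subst, liftSub_subst]

theorem liftSub_var : liftSub Tm.var = Tm.var := by
  funext i; cases i <;> rfl

theorem Tm.subst_var (t : Tm) : t.subst Tm.var = t := by
  induction t <;> simp_all [Tm.subst, liftSub_var]

/-- Extension of a substitution by a term for the innermost variable. -/
def consSub (u : Tm) (σ : ℕ → Tm) : ℕ → Tm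
  | 0 => u
  | i + 1 => σ i

theorem Tm.subst_liftSub_sub1 (σ : ℕ → Tm) (u t : Tm) :
    (t.subst (liftSub σ)).subst (sub1 u) = t.subst (consSub u σ) := by
  rw [Tm.subst_subst]
  congr 1; funext i
  cases i with
  | zero => rfl
  | succ i => exact (Tm.subst_rename _ _ _).trans (Tm.subst_var _)

theorem Tm.subst_liftSub_sub2 (σ : ℕ → Tm) (u v t : Tm) :
    (t.subst (liftSub (liftSub σ))).subst (sub2 u v) = t.subst (consSub v (consSub u σ)) := by
  rw [Tm.subst_subst]
  congr 1; funext i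
  match i with
  | 0 => rfl
  | 1 => rfl
  | i + 2 =>
    simp only [liftSub, consSub, Tm.subst_rename]
    exact Tm.subst_var _

/-! ### Typing of terms under substitution of closed terms -/

theorem Ctx.Split.eq_none {Γ Γ₁ Γ₂ : Ctx} (h : Ctx.Split Γ Γ₁ Γ₂) {i : ℕ} (hi : Γ i = none) :
    Γ₁ i = none ∧ Γ₂ i = none := by
  rcases h i with ⟨_, _⟩ | ⟨_, _⟩ <;> simp_all

theorem Ctx.Split.left_eq {Γ Γ₁ Γ₂ : Ctx} (h : Ctx.Split Γ Γ₁ Γ₂) {i : ℕ} {A : Ty}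
    (hi : Γ₁ i = some A) : Γ i = some A := by
  rcases h i with ⟨_, _⟩ | ⟨_, _⟩ <;> simp_all

theorem Ctx.Split.right_eq {Γ Γ₁ Γ₂ : Ctx} (h : Ctx.Split Γ Γ₁ Γ₂) {i : ℕ} {A : Ty}
    (hi : Γ₂ i = some A) : Γ i = some A := by
  rcases h i with ⟨_, _⟩ | ⟨_, _⟩ <;> simp_all

theorem Ctx.split_empty : Ctx.Split Ctx.empty Ctx.empty Ctx.empty := fun _ => .inl ⟨rfl, rfl⟩

theorem HasType.subst_eq {Γ : Ctx} {t : Tm} {A : Ty} (h : HasType Γ t A) {σ : ℕ → Tm}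
    (hσ : ∀ i, Γ i ≠ none → σ i = .var i) : t.subst σ = t := by
  induction h generalizing σ with
  | var i A => exact hσ i (by simp [Ctx.single])
  | lam _ ih =>
    rw [Tm.subst, ih]
    rintro (_ | i) hi
    · rfl
    · simp [liftSub, hσ i hi, Tm.rename]
  | app hs _ _ ih1 ih2 | pair hs _ _ ih1 ih2 =>
    rw [Tm.subst, ih1 fun i hi => hσ i fun h => hi (hs.eq_none h).1,
      ih2 fun i hi => hσ i fun h => hi (hs.eq_none h).2]
  | letp hs _ _ ih1 ih2 =>
    rw [Tm.subst, ih1 fun i hi => hσ i fun h => hi (hs.eq_none h).1, ih2]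
    rintro (_ | _ | i) hi
    · rfl
    · rfl
    · simp [liftSub, hσ i fun h => hi (hs.eq_none h).2, Tm.rename]

theorem ClosedTerm.subst_eq {t : Tm} {A : Ty} (h : ClosedTerm t A) (σ : ℕ → Tm) :
    t.subst σ = t :=
  HasType.subst_eq h fun _ hi => absurd rfl hi

theorem ClosedTerm.rename_eq {t : Tm} {A : Ty} (h : ClosedTerm t A) (ρ : ℕ → ℕ) :
    t.rename ρ = t := by
  rw [← Tm.subst_var (t.rename ρ), Tm.subst_rename, h.subst_eq]

/-- `σ` replaces some of the variables declared by `Γ` by closed terms of the declared types and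
keeps the other ones, which are those that `Δ` declares. -/
def ClosingSub (Γ Δ : Ctx) (σ : ℕ → Tm) : Prop :=
  ∀ i, (Γ i = Δ i ∧ (Γ i ≠ none → σ i = .var i)) ∨
    (Δ i = none ∧ ∃ A, Γ i = some A ∧ ClosedTerm (σ i) A)

theorem ClosingSub.cons {Γ Δ : Ctx} {σ : ℕ → Tm} (h : ClosingSub Γ Δ σ) (A : Ty) :
    ClosingSub (Ctx.cons A Γ) (Ctx.cons A Δ) (liftSub σ) := by
  rintro (_ | i)
  · exact .inl ⟨rfl, fun _ => rfl⟩
  · rcases h i with ⟨h1, h2⟩ | ⟨h1, B, h2, h3⟩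
    · exact .inl ⟨h1, fun hi => by simp [liftSub, h2 hi, Tm.rename]⟩
    · exact .inr ⟨h1, B, h2, by simpa [liftSub, h3.rename_eq] using h3⟩

theorem ClosingSub.split {Γ Γ₁ Γ₂ Δ : Ctx} {σ : ℕ → Tm} (h : ClosingSub Γ Δ σ)
    (hs : Ctx.Split Γ Γ₁ Γ₂) :
    ∃ Δ₁ Δ₂, Ctx.Split Δ Δ₁ Δ₂ ∧ ClosingSub Γ₁ Δ₁ σ ∧ ClosingSub Γ₂ Δ₂ σ := by
  -- The surviving variables are distributed according to the side of the split that declares them.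
  refine ⟨fun i => if Γ₁ i = none then none else Δ i, fun i => if Γ₂ i = none then none else Δ i,
    fun i => ?_, fun i => ?_, fun i => ?_⟩ <;>
  · rcases hs i with ⟨_, _⟩ | ⟨_, _⟩ <;> rcases h i with ⟨_, _⟩ | ⟨_, _, _, _⟩ <;>
      by_cases Γ₁ i = none <;> by_cases Γ₂ i = none <;> grind

/-- Closed terms need no declarations, so substituting them merely removes variables from the
context and every split survives. -/
theorem HasType.closingSub {Γ Δ : Ctx} {t : Tm} {A : Ty} (h : HasType Γ t A) {σ : ℕ → Tm}
    (hσ : ClosingSub Γ Δ σ) : HasType Δ (t.subst σ) A := by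
  induction h generalizing Δ σ with
  | var i A =>
    have hne : ∀ j, j ≠ i → Δ j = none := fun j hj => by
      rcases hσ j with ⟨h1, -⟩ | ⟨h1, -⟩
      · rw [← h1]; simp [Ctx.single, hj]
      · exact h1
    rcases hσ i with ⟨h1, h2⟩ | ⟨h1, B, h2, h3⟩
    · have : Δ = Ctx.single i A := by
        funext j
        by_cases hj : j = i
        · rw [hj, ← h1]
        · simp [hne j hj, Ctx.single, hj]
      rw [this, Tm.subst, h2 (by simp [Ctx.single])]
      exact .var i A
    · have : Δ = Ctx.empty := by
        funext j
        by_cases hj : j = i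
        · rw [hj, h1]; rfl
        · rw [hne j hj]; rfl
      obtain rfl : A = B := by simpa [Ctx.single] using h2
      rw [this]; exact h3
  | lam _ ih => exact .lam (ih (hσ.cons _))
  | app hs _ _ ih1 ih2 =>
    obtain ⟨Δ₁, Δ₂, hd, h1, h2⟩ := hσ.split hs
    exact .app hd (ih1 h1) (ih2 h2)
  | pair hs _ _ ih1 ih2 =>
    obtain ⟨Δ₁, Δ₂, hd, h1, h2⟩ := hσ.split hs
    exact .pair hd (ih1 h1) (ih2 h2)
  | letp hs _ _ ih1 ih2 =>
    obtain ⟨Δ₁, Δ₂, hd, h1, h2⟩ := hσ.split hs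
    exact .letp hd (ih1 h1) (ih2 ((h2.cons _).cons _))

/-! ### Typed equality of closed terms -/

theorem EqTm.of_rule {Γ : Ctx} {t u : Tm} {A : Ty} (h : HasType Γ t A) (hr : BetaEtaRule t u) :
    EqTm Γ t u A :=
  .red h ⟨t, u, .refl _, .mk .hole hr, .refl _⟩

theorem ClosedTerm.app {t s : Tm} {A B : Ty} (ht : ClosedTerm t (.imp A B))
    (hs : ClosedTerm s A) : ClosedTerm (.app t s) B :=
  HasType.app Ctx.split_empty ht hs

theorem EqTm.app_closed {t t' s s' : Tm} {A B : Ty} (ht : EqTm Ctx.empty t t' (.imp A B))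
    (hs : EqTm Ctx.empty s s' A) : EqTm Ctx.empty (.app t s) (.app t' s') B :=
  .app Ctx.split_empty ht hs

theorem EqTm.app_left {t t' s : Tm} {A B : Ty} (ht : EqTm Ctx.empty t t' (.imp A B))
    (hs : ClosedTerm s A) : EqTm Ctx.empty (.app t s) (.app t' s) B :=
  ht.app_closed (.refl hs)

/-! ### The logical relation -/

/-- The instance of a type in which all type variables are replaced by `B ⊸ B`. -/
def Ty.endo (A B : Ty) : Ty := A.subst fun _ => .imp B B

/-- Hereditarily trivial closed terms of type `A.endo B`: those of type `B ⊸ B` that come from a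
type variable are equal to `I`. -/
def Red (B : Ty) : Ty → Tm → Prop
  | .var a, t => ClosedTerm t (Ty.endo (.var a) B) ∧
      EqTm Ctx.empty t Tm.I (Ty.endo (.var a) B)
  | .tensor X Y, t => ClosedTerm t (Ty.endo (.tensor X Y) B) ∧
      ∃ u v, Red B X u ∧ Red B Y v ∧ EqTm Ctx.empty t (.pair u v) (Ty.endo (.tensor X Y) B)
  | .imp X Y, t => ClosedTerm t (Ty.endo (.imp X Y) B) ∧ ∀ u, Red B X u → Red B Y (.app t u)

variable {B : Ty}

theorem Red.closed {A : Ty} {t : Tm} (h : Red B A t) : ClosedTerm t (A.endo B) := by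
  cases A <;> exact h.1

/-- Closure under expansion, as the fundamental lemma requires. Typability of `t` is assumed
separately, so no preservation of typing under equality is needed. -/
theorem Red.of_eq {A : Ty} {t t' : Tm} (h : Red B A t') (ht : ClosedTerm t (A.endo B))
    (he : EqTm Ctx.empty t t' (A.endo B)) : Red B A t := by
  induction A generalizing t t' with
  | var a => exact ⟨ht, he.trans h.2⟩
  | tensor X Y =>
    obtain ⟨-, u, v, hu, hv, h⟩ := h
    exact ⟨ht, u, v, hu, hv, he.trans h⟩
  | imp X Y _ ih =>
    exact ⟨ht, fun u hu => ih (h.2 u hu) (ClosedTerm.app ht hu.closed) (he.app_left hu.closed)⟩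

theorem Red.of_rule {A : Ty} {t t' : Tm} (h : Red B A t') (ht : ClosedTerm t (A.endo B))
    (hr : BetaEtaRule t t') : Red B A t :=
  h.of_eq ht (.of_rule ht hr)

theorem ClosingSub.of_red {Γ : Ctx} {σ : ℕ → Tm} (h : ∀ i A, Γ i = some A → Red B A (σ i)) :
    ClosingSub (Γ.subst fun _ => .imp B B) Ctx.empty σ := by
  intro i
  cases hi : Γ i with
  | none => exact .inl (by simp [Ctx.subst, hi, Ctx.empty])
  | some A => exact .inr ⟨rfl, A.endo B, by simp [Ctx.subst, hi, Ty.endo], (h i A hi).closed⟩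

/-- The fundamental lemma: abstractions and `let` are handled by β-expansion, the remaining
constructors directly by the definition of `Red`. -/
theorem HasType.red {Γ : Ctx} {t : Tm} {A : Ty} (h : HasType Γ t A) {σ : ℕ → Tm}
    (hσ : ∀ i A, Γ i = some A → Red B A (σ i)) : Red B A (t.subst σ) := by
  have hcl : ClosedTerm (t.subst σ) (A.endo B) :=
    (h.tySubst fun _ => .imp B B).closingSub (.of_red hσ)
  induction h generalizing σ with
  | var i A => exact hσ i A (by simp [Ctx.single])
  | @lam Γ t X Y h ih =>
    refine ⟨hcl, fun u hu => ?_⟩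
    have hσ' : ∀ i Z, Ctx.cons X Γ i = some Z → Red B Z (consSub u σ i) := by
      rintro (_ | i) Z hi
      · cases hi; exact hu
      · exact hσ i Z hi
    refine (ih hσ' ((h.tySubst fun _ => .imp B B).closingSub (.of_red hσ'))).of_rule
      (ClosedTerm.app hcl hu.closed) ?_
    rw [← Tm.subst_liftSub_sub1]
    exact .beta1 _ _
  | app hs h1 h2 ih1 ih2 =>
    have hσ1 := fun i A hi => hσ i A (hs.left_eq hi)
    have hσ2 := fun i A hi => hσ i A (hs.right_eq hi)
    exact (ih1 hσ1 ((h1.tySubst _).closingSub (.of_red hσ1))).2 _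
      (ih2 hσ2 ((h2.tySubst _).closingSub (.of_red hσ2)))
  | pair hs h1 h2 ih1 ih2 =>
    have hσ1 := fun i A hi => hσ i A (hs.left_eq hi)
    have hσ2 := fun i A hi => hσ i A (hs.right_eq hi)
    exact ⟨hcl, _, _, ih1 hσ1 ((h1.tySubst _).closingSub (.of_red hσ1)),
      ih2 hσ2 ((h2.tySubst _).closingSub (.of_red hσ2)), .refl hcl⟩
  | @letp Γ Γ₁ Γ₂ s t X Y C hs h1 h2 ih1 ih2 =>
    have hσ1 := fun i A hi => hσ i A (hs.left_eq hi)
    obtain ⟨-, u, v, hu, hv, he⟩ := ih1 hσ1 ((h1.tySubst _).closingSub (.of_red hσ1))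
    have hσ2 : ∀ i Z, Ctx.cons Y (Ctx.cons X Γ₂) i = some Z →
        Red B Z (consSub v (consSub u σ) i) := by
      rintro (_ | _ | i) Z hi
      · cases hi; exact hv
      · cases hi; exact hu
      · exact hσ i Z (hs.right_eq hi)
    have hbody : HasType (Ctx.cons (Y.endo B) (Ctx.cons (X.endo B) Ctx.empty))
        (t.subst (liftSub (liftSub σ))) (C.endo B) := by
      have := h2.tySubst fun _ => .imp B B
      rw [Ctx.subst_cons, Ctx.subst_cons] at this
      exact this.closingSub (((ClosingSub.of_red fun i Z hi => hσ i Z (hs.right_eq hi)).cons _).cons _)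
    -- The scrutinee is replaced by the equal pair of `u` and `v`, and then `β₂` fires.
    refine (ih2 hσ2 ((h2.tySubst _).closingSub (.of_red hσ2))).of_eq hcl
      ((EqTm.letp Ctx.split_empty he (.refl hbody)).trans (.of_rule ?_ ?_))
    · exact .letp Ctx.split_empty (.pair Ctx.split_empty hu.closed hv.closed) hbody
    · rw [← Tm.subst_liftSub_sub2]
      exact .beta2 _ _ _

theorem ClosedTerm.red {t : Tm} {A : Ty} (h : ClosedTerm t A) : Red B A t := by
  have := HasType.red (B := B) h (σ := Tm.var) (fun _ _ hi => nomatch hi)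
  rwa [Tm.subst_var] at this

/-! ### Synthesis of contexts -/

/-- With unions and tails the context is computed from the term upwards, so typing an explicit
combinator leaves only disjointness and lookup goals. -/
def Ctx.union (Γ₁ Γ₂ : Ctx) : Ctx := fun i => (Γ₁ i).or (Γ₂ i)

def Ctx.Disjoint (Γ₁ Γ₂ : Ctx) : Prop := ∀ i, Γ₁ i = none ∨ Γ₂ i = none

def Ctx.tail (Γ : Ctx) : Ctx := fun i => Γ (i + 1)

theorem Ctx.Disjoint.split {Γ₁ Γ₂ : Ctx} (h : Ctx.Disjoint Γ₁ Γ₂) :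
    Ctx.Split (Γ₁.union Γ₂) Γ₁ Γ₂ := by
  intro i
  rcases h i with h | h <;> simp [Ctx.union, h]

theorem Ctx.cons_tail {Γ : Ctx} {A : Ty} (h : Γ 0 = some A) : Ctx.cons A Γ.tail = Γ := by
  funext i
  cases i
  · exact h.symm
  · rfl

theorem HasType.lam_tail {Γ : Ctx} {t : Tm} {A B : Ty} (ht : HasType Γ t B)
    (h : Γ 0 = some A) : HasType Γ.tail (.lam t) (.imp A B) :=
  .lam (by rwa [Ctx.cons_tail h])

theorem HasType.app_union {Γ₁ Γ₂ : Ctx} {t s : Tm} {A B : Ty} (ht : HasType Γ₁ t (.imp A B))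
    (hs : HasType Γ₂ s A) (h : Ctx.Disjoint Γ₁ Γ₂) : HasType (Γ₁.union Γ₂) (.app t s) B :=
  .app h.split ht hs

theorem HasType.pair_union {Γ₁ Γ₂ : Ctx} {s t : Tm} {A B : Ty} (hs : HasType Γ₁ s A)
    (ht : HasType Γ₂ t B) (h : Ctx.Disjoint Γ₁ Γ₂) :
    HasType (Γ₁.union Γ₂) (.pair s t) (.tensor A B) :=
  .pair h.split hs ht

theorem HasType.letp_union {Γ₁ Γ₂ : Ctx} {s t : Tm} {A B C : Ty}
    (hs : HasType Γ₁ s (.tensor A B)) (ht : HasType Γ₂ t C) (hB : Γ₂ 0 = some B)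
    (hA : Γ₂ 1 = some A) (h : Ctx.Disjoint Γ₁ Γ₂.tail.tail) :
    HasType (Γ₁.union Γ₂.tail.tail) (.letp s t) C :=
  .letp h.split hs (by rwa [Ctx.cons_tail (Γ := Γ₂.tail) hA, Ctx.cons_tail hB])

theorem HasType.closedTerm {Γ : Ctx} {t : Tm} {A : Ty} (ht : HasType Γ t A)
    (h : ∀ i, Γ i = none) : ClosedTerm t A := by
  obtain rfl : Γ = Ctx.empty := funext h
  exact ht

/-! ### Erasers -/

theorem Red.app {X Y : Ty} {t s : Tm} (ht : Red B (.imp X Y) t) (hs : Red B X s) :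
    Red B Y (.app t s) :=
  ht.2 s hs

theorem EqTm.beta_closed {t s u : Tm} {A C : Ty} (ht : ClosedTerm (.lam t) (.imp A C))
    (hs : ClosedTerm s A) (hu : t.subst (sub1 s) = u) :
    EqTm Ctx.empty (.app (.lam t) s) u C :=
  hu ▸ .of_rule (ht.app hs) (.beta1 t s)

theorem HasType.I (A : Ty) : HasType Ctx.empty Tm.I (.imp A A) :=
  HasType.closedTerm ((HasType.var 0 A).lam_tail rfl) fun _ => by simp [Ctx.tail, Ctx.single]

theorem HasType.I_app {Γ : Ctx} {t : Tm} {A : Ty} (ht : HasType Γ t A) :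
    HasType Γ (.app .I t) A :=
  .app (fun _ => .inr ⟨rfl, rfl⟩) (.I A) ht

theorem EqTm.I_app {Γ : Ctx} {t : Tm} {A : Ty} (ht : HasType Γ t A) :
    EqTm Γ (.app .I t) t A :=
  .of_rule ht.I_app (.beta1 (.var 0) t)

theorem Red.I (a : ℕ) : Red B (.var a) .I := ⟨.I B, .refl (.I B)⟩

theorem closedTerm_comp (X Y Z : Ty) :
    ClosedTerm (.lam (.lam (.lam (.app (.var 2) (.app (.var 1) (.var 0))))))
      (.imp (.imp Y Z) (.imp (.imp X Y) (.imp X Z))) :=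
  HasType.closedTerm (((((HasType.var 2 (.imp Y Z)).app_union ((HasType.var 1 (.imp X Y)).app_union
    (.var 0 X) (by grind [Ctx.Disjoint, Ctx.single])) (by grind [Ctx.Disjoint, Ctx.single, Ctx.union])).lam_tail
      rfl).lam_tail rfl).lam_tail rfl) (fun _ => by simp [Ctx.tail, Ctx.single, Ctx.union])

/-- All variables become `B ⊸ B`, where composition makes sense, and the composite of two identities
is an identity. -/
theorem Red.comp (a b c : ℕ) : Red B (.imp (.var a) (.imp (.var b) (.var c)))
    (.lam (.lam (.lam (.app (.var 2) (.app (.var 1) (.var 0)))))) := by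
  have hc : ClosedTerm _ (.imp (.imp B B) (.imp (.imp B B) (.imp B B))) := closedTerm_comp B B B
  have hI : ClosedTerm Tm.I (.imp B B) := .I B
  refine ⟨hc, fun f hf => ⟨hc.app hf.closed, fun g hg => ⟨(hc.app hf.closed).app hg.closed, ?_⟩⟩⟩
  have h1 : ClosedTerm (.lam (.lam (.app .I (.app (.var 1) (.var 0)))))
      (.imp (.imp B B) (.imp B B)) :=
    HasType.closedTerm ((((HasType.var 1 (.imp B B)).app_union (.var 0 B)
      (by grind [Ctx.Disjoint, Ctx.single])).I_app.lam_tail rfl).lam_tail rfl)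
      (fun _ => by simp [Ctx.tail, Ctx.single, Ctx.union])
  have h2 : HasType (Ctx.cons B Ctx.empty) (.var 0) B := by
    convert HasType.var 0 B using 1
    funext i
    cases i <;> rfl
  exact (((EqTm.refl hc).app_closed hf.2).app_closed hg.2).trans <|
    ((EqTm.beta_closed hc hI rfl).app_left hI).trans <|
    (EqTm.beta_closed h1 hI rfl).trans <|
    .lam ((EqTm.I_app h2.I_app).trans (.I_app h2))

/-! ### Combinators for the induction on types, and the eraser -/

theorem closedTerm_actImp (O X Y : Ty) :
    ClosedTerm (.lam (.lam (.lam (.lam (.app (.app (.var 3) (.var 2)) (.app (.var 1) (.var 0)))))))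
      (.imp (.imp O (.imp Y Y)) (.imp O (.imp (.imp X Y) (.imp X Y)))) :=
  HasType.closedTerm (((((((HasType.var 3 (.imp O (.imp Y Y))).app_union (.var 2 O)
    (by grind [Ctx.Disjoint, Ctx.single])).app_union
      ((HasType.var 1 (.imp X Y)).app_union (.var 0 X) (by grind [Ctx.Disjoint, Ctx.single]))
      (by grind [Ctx.Disjoint, Ctx.single, Ctx.union])).lam_tail
        rfl).lam_tail rfl).lam_tail rfl).lam_tail rfl) (fun _ => by simp [Ctx.tail, Ctx.single, Ctx.union])

theorem closedTerm_actTensor (O X Y : Ty) :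
    ClosedTerm (.lam (.lam (.lam (.letp (.var 0)
        (.pair (.app (.app (.var 4) (.var 3)) (.var 1)) (.var 0))))))
      (.imp (.imp O (.imp X X)) (.imp O (.imp (.tensor X Y) (.tensor X Y)))) :=
  HasType.closedTerm (((((HasType.var 0 (.tensor X Y)).letp_union
    ((((HasType.var 4 (.imp O (.imp X X))).app_union (.var 3 O)
      (by grind [Ctx.Disjoint, Ctx.single])).app_union (.var 1 X)
        (by grind [Ctx.Disjoint, Ctx.single, Ctx.union])).pair_union (.var 0 Y)
          (by grind [Ctx.Disjoint, Ctx.single, Ctx.union])) rfl rfl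
      (by grind [Ctx.Disjoint, Ctx.tail, Ctx.single, Ctx.union])).lam_tail rfl).lam_tail
        rfl).lam_tail rfl) (fun _ => by simp [Ctx.tail, Ctx.single, Ctx.union])

theorem closedTerm_eraseImp (O X Y : Ty) :
    ClosedTerm (.lam (.lam (.lam (.app (.var 2) (.app (.var 0) (.var 1))))))
      (.imp (.imp Y O) (.imp X (.imp (.imp X Y) O))) :=
  HasType.closedTerm (((((HasType.var 2 (.imp Y O)).app_union ((HasType.var 0 (.imp X Y)).app_union
    (.var 1 X) (by grind [Ctx.Disjoint, Ctx.single])) (by grind [Ctx.Disjoint, Ctx.single, Ctx.union])).lam_tail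
      rfl).lam_tail rfl).lam_tail rfl) (fun _ => by simp [Ctx.tail, Ctx.single, Ctx.union])

theorem closedTerm_eraseTensor (O X Y : Ty) :
    ClosedTerm (.lam (.lam (.lam (.lam (.letp (.var 0)
        (.app (.app (.var 5) (.app (.var 4) (.var 1))) (.app (.var 3) (.var 0))))))))
      (.imp (.imp O (.imp O O)) (.imp (.imp X O) (.imp (.imp Y O) (.imp (.tensor X Y) O)))) :=
  HasType.closedTerm ((((((HasType.var 0 (.tensor X Y)).letp_union
    (((HasType.var 5 (.imp O (.imp O O))).app_union ((HasType.var 4 (.imp X O)).app_union (.var 1 X)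
      (by grind [Ctx.Disjoint, Ctx.single])) (by grind [Ctx.Disjoint, Ctx.single, Ctx.union])).app_union
        ((HasType.var 3 (.imp Y O)).app_union (.var 0 Y) (by grind [Ctx.Disjoint, Ctx.single]))
          (by grind [Ctx.Disjoint, Ctx.single, Ctx.union])) rfl rfl
      (by grind [Ctx.Disjoint, Ctx.tail, Ctx.single, Ctx.union])).lam_tail rfl).lam_tail
        rfl).lam_tail rfl).lam_tail rfl) (fun _ => by simp [Ctx.tail, Ctx.single, Ctx.union])

/-- The argument of the generated function is erased into `O`, and the result is consumed by letting
it act on the given element of `Y`. -/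
theorem closedTerm_genImp (O X Y : Ty) :
    ClosedTerm (.lam (.lam (.lam (.lam (.app (.app (.var 3) (.app (.var 2) (.var 0))) (.var 1))))))
      (.imp (.imp O (.imp Y Y)) (.imp (.imp X O) (.imp Y (.imp X Y)))) :=
  HasType.closedTerm (((((((HasType.var 3 (.imp O (.imp Y Y))).app_union
    ((HasType.var 2 (.imp X O)).app_union (.var 0 X) (by grind [Ctx.Disjoint, Ctx.single]))
      (by grind [Ctx.Disjoint, Ctx.single, Ctx.union])).app_union (.var 1 Y)
        (by grind [Ctx.Disjoint, Ctx.single, Ctx.union])).lam_tail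
          rfl).lam_tail rfl).lam_tail rfl).lam_tail rfl) (fun _ => by simp [Ctx.tail, Ctx.single, Ctx.union])

/-- The type variable `0`, whose instance is `B ⊸ B`, acts on every type by hereditarily
trivial terms. -/
theorem Red.exists_act (B A : Ty) : ∃ t, Red B (.imp (.var 0) (.imp A A)) t := by
  induction A with
  | var a => exact ⟨_, .comp 0 a a⟩
  | tensor X Y ih _ =>
    obtain ⟨t, ht⟩ := ih
    exact ⟨_, (closedTerm_actTensor (.var 0) X Y).red.app ht⟩
  | imp X Y _ ih =>
    obtain ⟨t, ht⟩ := ih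
    exact ⟨_, (closedTerm_actImp (.var 0) X Y).red.app ht⟩

/-- The two halves need each other: erasing a function requires an argument to feed it, and
generating a function requires erasing its argument. The inhabitant lives only in the instance of
`A`, so it exists for every `A`. -/
theorem Red.exists_erase_and_gen (B A : Ty) :
    (∃ t, Red B (.imp A (.var 0)) t) ∧ ∃ t, Red B A t := by
  induction A with
  | var a =>
    -- The variables `a` and `0` have the same instance `B ⊸ B`, so the identity is an eraser.
    exact ⟨⟨.I, .I _, fun u hu => Red.of_rule (A := .var 0) hu
      (ClosedTerm.app (.I _) hu.closed) (.beta1 (.var 0) u)⟩, ⟨_, .I a⟩⟩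
  | tensor X Y ih1 ih2 =>
    obtain ⟨⟨e₁, he₁⟩, g₁, hg₁⟩ := ih1
    obtain ⟨⟨e₂, he₂⟩, g₂, hg₂⟩ := ih2
    have hp : ClosedTerm (.pair g₁ g₂) (Ty.endo (.tensor X Y) B) :=
      .pair Ctx.split_empty hg₁.closed hg₂.closed
    exact ⟨⟨_, (((closedTerm_eraseTensor (.var 0) X Y).red.app (.comp 0 0 0)).app he₁).app he₂⟩,
      ⟨_, hp, g₁, g₂, hg₁, hg₂, .refl hp⟩⟩
  | imp X Y ih1 ih2 =>
    obtain ⟨⟨e₁, he₁⟩, g₁, hg₁⟩ := ih1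
    obtain ⟨⟨e₂, he₂⟩, g₂, hg₂⟩ := ih2
    obtain ⟨t, ht⟩ := exists_act B Y
    exact ⟨⟨_, ((closedTerm_eraseImp (.var 0) X Y).red.app he₂).app hg₁⟩,
      ⟨_, (((closedTerm_genImp (.var 0) X Y).red.app ht).app he₁).app hg₂⟩⟩

/-- The Projection Lemma for a fixed instance of `A`. -/
theorem exists_eraser (A B : Ty) : ∃ t, ClosedTerm t (.imp (A.endo B) (.imp B B)) ∧
    ∀ s, ClosedTerm s A → EqTm Ctx.empty (.app t s) .I (.imp B B) := by
  obtain ⟨⟨t, ht⟩, -⟩ := Red.exists_erase_and_gen B A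
  exact ⟨t, ht.closed, fun s hs => (ht.app hs.red).2⟩

/-! ### Projections -/

theorem Ty.arrows_ofFn_succ {n : ℕ} (A : Fin (n + 1) → Ty) (C : Ty) :
    Ty.arrows (List.ofFn A) C = .imp (A 0) (Ty.arrows (List.ofFn fun j => A j.succ) C) := by
  simp [Ty.arrows, List.ofFn_succ]

theorem Tm.apps_ofFn_succ {n : ℕ} (t : Tm) (s : Fin (n + 1) → Tm) :
    Tm.apps t (List.ofFn s) = Tm.apps (.app t (s 0)) (List.ofFn fun j => s j.succ) := by
  simp [Tm.apps, List.ofFn_succ]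

theorem EqTm.apps {n : ℕ} {t t' : Tm} {s : Fin n → Tm} {A : Fin n → Ty} {C : Ty}
    (h : EqTm Ctx.empty t t' (Ty.arrows (List.ofFn A) C)) (hs : ∀ j, ClosedTerm (s j) (A j)) :
    EqTm Ctx.empty (Tm.apps t (List.ofFn s)) (Tm.apps t' (List.ofFn s)) C := by
  induction n generalizing t t' with
  | zero => simpa [Ty.arrows, Tm.apps] using h
  | succ n ih =>
    rw [Ty.arrows_ofFn_succ] at h
    rw [Tm.apps_ofFn_succ, Tm.apps_ofFn_succ]
    exact ih (h.app_left (hs 0)) fun j => hs j.succ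

theorem closedTerm_erase_then {X T : Ty} {e p : Tm} (he : ClosedTerm e (.imp X (.imp T T)))
    (hp : ClosedTerm p T) : ClosedTerm (.lam (.app (.app e (.var 0)) p)) (.imp X T) :=
  HasType.closedTerm (((HasType.app_union he (.var 0 X) fun _ => .inl rfl).app_union hp
    fun _ => .inr rfl).lam_tail rfl) (fun _ => by simp [Ctx.tail, Ctx.single, Ctx.union, Ctx.empty])

theorem EqTm.erase_then {X T : Ty} {e p s : Tm} (he : ClosedTerm e (.imp X (.imp T T)))
    (hp : ClosedTerm p T) (hs : ClosedTerm s X)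
    (hes : EqTm Ctx.empty (.app e s) .I (.imp T T)) :
    EqTm Ctx.empty (.app (.lam (.app (.app e (.var 0)) p)) s) p T := by
  refine (EqTm.beta_closed (closedTerm_erase_then he hp) hs (u := .app (.app e s) p) ?_).trans
    ((hes.app_left hp).trans (.I_app hp))
  simp [Tm.subst, he.subst_eq, hp.subst_eq, sub1]

/-- A closed term that erases its first argument, a closed term of type `A`, and returns `p`. -/
theorem exists_const (A : Ty) {T : Ty} {p : Tm} (hp : ClosedTerm p T) :
    ∃ t, ClosedTerm t (.imp (A.endo T) T) ∧
      ∀ s, ClosedTerm s A → EqTm Ctx.empty (.app t s) p T := by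
  obtain ⟨e, he, hes⟩ := exists_eraser A T
  exact ⟨_, closedTerm_erase_then he hp, fun s hs => .erase_then he hp (hs.tySubst _) (hes s hs)⟩

/-- A closed term that erases its second argument, a closed term of type `A`, and applies `p` to
its first argument. -/
theorem exists_const_snd (A : Ty) {X T : Ty} {p : Tm} (hp : ClosedTerm p (.imp X T)) :
    ∃ t, ClosedTerm t (.imp X (.imp (A.endo T) T)) ∧
      ∀ x s, ClosedTerm x X → ClosedTerm s A →
        EqTm Ctx.empty (.app (.app t x) s) (.app p x) T := by
  obtain ⟨e, he, hes⟩ := exists_eraser A T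
  have ht : ClosedTerm (.lam (.lam (.app (.app e (.var 0)) (.app p (.var 1)))))
      (.imp X (.imp (A.endo T) T)) :=
    HasType.closedTerm ((((HasType.app_union he (.var 0 (A.endo T)) fun _ => .inl rfl).app_union
      (HasType.app_union hp (.var 1 X) fun _ => .inl rfl)
      (by grind [Ctx.Disjoint, Ctx.single, Ctx.union, Ctx.empty])).lam_tail rfl).lam_tail rfl)
      (fun _ => by simp [Ctx.tail, Ctx.single, Ctx.union, Ctx.empty])
  refine ⟨_, ht, fun x s hx hs => (EqTm.app_left (EqTm.beta_closed ht hx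
    (u := .lam (.app (.app e (.var 0)) (.app p x))) ?_) (hs.tySubst _)).trans
    (.erase_then he (hp.app hx) (hs.tySubst _) (hes s hs))⟩
  simp [Tm.subst, he.subst_eq, hp.subst_eq, sub1, liftSub, hx.rename_eq]

/-- Projection to the first of several arguments. -/
theorem exists_proj_first (A : Ty) (n : ℕ) : ∃ (t : Tm) (θ : Fin n → ℕ → Ty),
    ClosedTerm t (.imp A (Ty.arrows (List.ofFn fun j => A.subst (θ j)) A)) ∧
      ∀ (x : Tm) (s : Fin n → Tm), ClosedTerm x A → (∀ j, ClosedTerm (s j) A) →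
        EqTm Ctx.empty (Tm.apps (.app t x) (List.ofFn s)) x A := by
  induction n with
  | zero =>
    exact ⟨.I, Fin.elim0, by exact HasType.I A, fun x s hx _ => by
      simpa [Tm.apps] using EqTm.I_app hx⟩
  | succ n ih =>
    obtain ⟨p, θ, hp, hps⟩ := ih
    obtain ⟨t, ht, hts⟩ := exists_const_snd A hp
    -- The erased argument must act as the identity on the whole remaining function type, so its
    -- instance of `A` grows with the number of later arguments.
    refine ⟨t, Fin.cons (fun _ => .imp (Ty.arrows (List.ofFn fun j => A.subst (θ j)) A)
        (Ty.arrows (List.ofFn fun j => A.subst (θ j)) A)) θ, ?_, fun x s hx hs => ?_⟩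
    · rw [Ty.arrows_ofFn_succ]; exact ht
    · rw [Tm.apps_ofFn_succ]
      exact (EqTm.apps (hts x (s 0) hx (hs 0)) fun j => (hs j.succ).tySubst _).trans
        (hps x _ hx fun j => hs j.succ)

theorem exists_proj (A : Ty) {n : ℕ} (i : Fin n) : ∃ (t : Tm) (θ : Fin n → ℕ → Ty),
    ClosedTerm t (Ty.arrows (List.ofFn fun j => A.subst (θ j)) A) ∧
      ∀ s : Fin n → Tm, (∀ j, ClosedTerm (s j) A) → EqTm Ctx.empty (Tm.apps t (List.ofFn s)) (s i) A := by
  induction n with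
  | zero => exact i.elim0
  | succ n ih =>
    cases i using Fin.cases with
    | zero =>
      obtain ⟨t, θ, ht, hts⟩ := exists_proj_first A n
      refine ⟨t, Fin.cons Ty.var θ, ?_, fun s hs => ?_⟩
      · rw [Ty.arrows_ofFn_succ, Fin.cons_zero, Ty.subst_var]; exact ht
      · rw [Tm.apps_ofFn_succ]
        exact hts _ _ (hs 0) fun j => hs j.succ
    | succ i =>
      -- Arguments before the chosen one are erased in turn, returning the projection for the
      -- remaining ones.
      obtain ⟨p, θ, hp, hps⟩ := ih i
      obtain ⟨t, ht, hts⟩ := exists_const A hp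
      refine ⟨t, Fin.cons (fun _ => .imp (Ty.arrows (List.ofFn fun j => A.subst (θ j)) A)
        (Ty.arrows (List.ofFn fun j => A.subst (θ j)) A)) θ, ?_, fun s hs => ?_⟩
      · rw [Ty.arrows_ofFn_succ]; exact ht
      · rw [Tm.apps_ofFn_succ]
        exact (EqTm.apps (hts (s 0) (hs 0)) fun j => (hs j.succ).tySubst _).trans
          (hps _ fun j => hs j.succ)

/-! ### Poly-typability -/

/-- Typings are stable under type substitution, so `s` also has the instance of `A` that `t`
expects; disjoint principal types then yield a common substitution. -/
theorem polyTypable_of_subst {t s : Tm} {A C : Ty} {θ : ℕ → Ty}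
    (ht : ClosedTerm t (.imp (A.subst θ) C)) (hs : ClosedTerm s A) : PolyTypable t s A C := by
  obtain ⟨P, η, hP⟩ := exists_principalTypes_subst
    (t := fun k => Nat.casesOn k t fun _ => s)
    (A := fun k => Nat.casesOn k (.imp (A.subst θ) C) fun _ => A.subst θ)
    (fun k => by cases k; exacts [ht, hs.tySubst θ])
  exact ⟨⟨_, _, ht⟩, hs, P 0, P 1, η, _, (hP 0).1, (hP 1).1, (hP 0).2, (hP 1).2⟩

theorem polyTypableN_of_subst {n : ℕ} {t : Tm} {s : Fin n → Tm} {A : Fin n → Ty} {C : Ty}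
    {θ : Fin n → ℕ → Ty}
    (ht : ClosedTerm t (Ty.arrows (List.ofFn fun j => (A j).subst (θ j)) C))
    (hs : ∀ j, ClosedTerm (s j) (A j)) : PolyTypableN t s A C := by
  obtain ⟨P, η, hP⟩ := exists_principalTypes_subst
    -- Indices below `n` hold the arguments; index `n` holds `t`, and later indices are padding.
    (t := fun k => if h : k < n then s ⟨k, h⟩ else t)
    (A := fun k => if h : k < n then (A ⟨k, h⟩).subst (θ ⟨k, h⟩) else
      Ty.arrows (List.ofFn fun j => (A j).subst (θ j)) C)
    (fun k => by
      by_cases h : k < n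
      · simpa [h] using (hs ⟨k, h⟩).tySubst _
      · simpa [h] using ht)
  refine ⟨⟨_, _, ht⟩, hs, P n, fun j => P j, η, fun j => (A j).subst (θ j), ?_, fun j => ?_, ?_,
    fun j => ?_⟩
  · simpa using (hP n).1
  · simpa using (hP j).1
  · simpa using (hP n).2
  · simpa using (hP j).2

end LinLam

theorem mainTheorem4 (A : LinLam.Ty) (hA : ∃ s : LinLam.Tm, LinLam.ClosedTerm s A) :
    (∀ B : LinLam.Ty, ∃ t : LinLam.Tm, ∀ s : LinLam.Tm, LinLam.ClosedTerm s A →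
      LinLam.PolyTypable t s A (LinLam.Ty.imp B B) ∧
      LinLam.EqTm LinLam.Ctx.empty (LinLam.Tm.app t s) LinLam.Tm.I (LinLam.Ty.imp B B)) ∧
    (∀ (n : ℕ) (i : Fin n), ∃ t : LinLam.Tm, ∀ s : Fin n → LinLam.Tm,
      (∀ j, LinLam.ClosedTerm (s j) A) →
      LinLam.PolyTypableN t s (fun _ => A) A ∧
      LinLam.EqTm LinLam.Ctx.empty (LinLam.Tm.apps t (List.ofFn s)) (s i) A) := by
  refine ⟨fun B => ?_, fun n i => ?_⟩
  · obtain ⟨t, ht, hts⟩ := LinLam.exists_eraser A B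
    exact ⟨t, fun s hs => ⟨LinLam.polyTypable_of_subst ht hs, hts s hs⟩⟩
  · obtain ⟨t, θ, ht, hts⟩ := LinLam.exists_proj A i
    exact ⟨t, fun s hs => ⟨LinLam.polyTypableN_of_subst ht hs, hts s hs⟩⟩
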